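/- Binary strings and natural numbers are identified by the standard length-lexicographic bijection. Let $U$ be a universal and additively optimal binary machine: a partial computable map $(y,p)\mapsto U(y,p)$ (input $y$, program $p$) such that every partial computable function of strings is $y\mapsto U(y,p)$ for some program $p$, and such that for every partial computable $V$ there is a constant $c$ for which $V(y,p)=x$ implies $U(y,q)=x$ for some $q$ with $|q|\le |p|+c$. Let $C(x)$ be the plain Kolmogorov complexity of $x$, i.e. the length of a shortest $p$ with $U(\epsilon,p)=x$; $C(n)$ is the complexity of the string identified with the number $n$. A real $\alpha$ is left c.e. if it is the limit of a computable nondecreasing sequence of rationals; write $\alpha_n$ for the string of its first $n$ binary digits after the binary point. **Theorem.** There is a computable function $D:\mathbb{N}\to\mathbb{N}$ (depending only on $U$) such that the following holds for every left c.e. real $\alpha$ whose binary digit sequence is not computable. There is a program $P$ of $U$ that enumerates a nondecreasing sequence of rationals converging to $\alpha$ (that is, on input $s$ it outputs the $s$-th term of the sequence, in a fixed coding of the rationals by numbers), and for every such program $P$, with $d=D(|P|)$, there is a partial function $C^*:\subseteq\mathbb{N}\to\mathbb{N}$, Turing computable from the digit sequence of $\alpha$, such that: 1. $C^*(n)$ is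 defined and $C^*(n)=C(n)$ at every $n$ with $C(\alpha_n)>C(n)+d$; 2. there are infinitely many $n$ with $C(\alpha_n)>C(n)+d$; 3. consequently $C^*(n)=C(n)$ for infinitely many $n$. -/

import Mathlib

/-- A machine: `U y p` is the output (if any) of program `p` on input `y`. -/
abbrev Machine := List Bool → List Bool →. List Bool

/-- `C_U(x | y)`: the length of a shortest program that outputs `x` on input `y`. (For the
additively optimal machines below the set is never empty, so the infimum is attained.) -/
noncomputable def condComplexity (U : Machine) (x y : List Bool) : ℕ :=
  sInf {l | ∃ p : List Bool, p.length = l ∧ x ∈ U y p}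

/-- `C_U(x) = C_U(x | ε)`. -/
noncomputable def complexity (U : Machine) (x : List Bool) : ℕ :=
  condComplexity U x []

/-- `U` is a universal and additively optimal machine: it is partial computable, every partial
computable function of strings is computed by one of its programs, and it gives shortest
descriptions up to an additive constant among all partial computable machines. -/
structure IsUniversalOptimal (U : Machine) : Prop where
  partrec : Partrec₂ U
  universal : ∀ f : List Bool →. List Bool, Partrec f → ∃ p, ∀ y, U y p = f y
  optimal : ∀ V : Machine, Partrec₂ V →
    ∃ c : ℕ, ∀ x y p, x ∈ V y p → ∃ q, x ∈ U y q ∧ q.length ≤ p.length + c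

/-- The standard identification of natural numbers with binary strings in length-lexicographic
order: `0 ↦ ε`, `1 ↦ 0`, `2 ↦ 1`, `3 ↦ 00`, ...; the string of `n` is the binary expansion of
`n + 1` without its leading `1`. -/
def natToStr (n : ℕ) : List Bool := (n + 1).bits.dropLast.reverse

/-- The inverse of `natToStr`. -/
def strToNat (x : List Bool) : ℕ := x.foldl (fun m b => 2 * m + b.toNat) 1 - 1

theorem natToStr_zero : natToStr 0 = [] := by simp [natToStr]

theorem natToStr_bit (n : ℕ) (b : Bool) : natToStr (2 * n + 1 + b.toNat) = natToStr n ++ [b] := by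
  have h : 2 * n + 1 + b.toNat + 1 = Nat.bit b (n+1) := by cases b <;> simp [Nat.bit] <;> ring
  have hne : (n+1).bits ≠ [] := by
    intro h'; have := congrArg List.length h'; rw [Nat.size_eq_bits_len] at this; simp [Nat.size_eq_zero] at this
  rw [natToStr, h, Nat.bits_append_bit _ _ (by simp), List.dropLast_cons_of_ne_nil hne]
  simp [natToStr]

theorem strToNat_append (x : List Bool) (b : Bool) : strToNat (x ++ [b]) = 2 * strToNat x + 1 + b.toNat := by
  have : ∀ (x : List Bool) m, 1 ≤ m → 1 ≤ x.foldl (fun m b => 2 * m + b.toNat) m := by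
    intro x; induction x with
    | nil => intro m hm; simpa using hm
    | cons a l ih => intro m hm; rw [List.foldl_cons]; apply ih; omega
  have := this x 1 le_rfl
  simp only [strToNat, List.foldl_append, List.foldl_cons, List.foldl_nil]; omega

theorem natToStr_strToNat (x : List Bool) : natToStr (strToNat x) = x := by
  induction x using List.reverseRecOn with
  | nil => simp [strToNat, natToStr_zero]
  | append_singleton l b ih => rw [strToNat_append, natToStr_bit, ih]

theorem strToNat_natToStr (n : ℕ) : strToNat (natToStr n) = n := by
  induction n using Nat.strong_induction_on with
  | _ n ih =>
    rcases Nat.eq_zero_or_pos n with rfl | hn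
    · simp [natToStr_zero, strToNat]
    · obtain ⟨m, b, rfl⟩ : ∃ m, ∃ b : Bool, n = 2 * m + 1 + b.toNat := by
        rcases Nat.even_or_odd' n with ⟨k, h | h⟩
        · exact ⟨k-1, true, by simp; omega⟩
        · exact ⟨k, false, by simp; omega⟩
      rw [natToStr_bit, strToNat_append, ih m (by omega)]

/-- `C_U(n)` for a natural number `n`. -/
noncomputable def natComplexity (U : Machine) (n : ℕ) : ℕ := complexity U (natToStr n)

/-- A numbering of the rationals: the triple `(a, b, c)` of naturals stands for
`(a - b) / (c + 1)`. -/
def natToRat (m : ℕ) : ℚ :=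
  ((m.unpair.1.unpair.1 : ℚ) - (m.unpair.1.unpair.2 : ℚ)) / ((m.unpair.2 : ℚ) + 1)

theorem natToRat_surjective : Function.Surjective natToRat := by
  intro r
  refine ⟨Nat.pair (Nat.pair r.num.toNat (-r.num).toNat) (r.den - 1), ?_⟩
  simp only [natToRat, Nat.unpair_pair]
  have h1 : ((r.num.toNat : ℚ) - ((-r.num).toNat : ℚ)) = r.num := by
    have : ((r.num.toNat : ℤ) - ((-r.num).toNat : ℤ)) = r.num := by omega
    exact_mod_cast this
  have h2 : (((r.den - 1 : ℕ) : ℚ) + 1) = r.den := by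
    have := r.den_pos
    have : r.den - 1 + 1 = r.den := by omega
    exact_mod_cast this
  rw [h1, h2, Rat.num_div_den]

/-- A real is left c.e. if it is the limit of a computable nondecreasing sequence of rationals. -/
def IsLeftCE (α : ℝ) : Prop :=
  ∃ q : ℕ → ℕ, Computable q ∧ Monotone (fun s => natToRat (q s)) ∧
    Filter.Tendsto (fun s => (natToRat (q s) : ℝ)) Filter.atTop (nhds α)

/-- `P` is a program for the machine `U` that enumerates a nondecreasing sequence of rationals
converging to `α`: on input (the string of) `s` it outputs (the string of a code of) the `s`-th
term. -/
def Enumerates (U : Machine) (P : List Bool) (α : ℝ) : Prop :=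
  ∃ q : ℕ → ℕ, (∀ s, natToStr (q s) ∈ U (natToStr s) P) ∧
    Monotone (fun s => natToRat (q s)) ∧
    Filter.Tendsto (fun s => (natToRat (q s) : ℝ)) Filter.atTop (nhds α)

/-- The binary digits of `α` after the binary point: `binDigit α k` is the digit of weight
`2 ^ (-(k + 1))`. -/
noncomputable def binDigit (α : ℝ) (k : ℕ) : Bool := decide (⌊(2 : ℝ) ^ (k + 1) * α⌋ % 2 = 1)

/-- The initial segment `α_n`, the first `n` binary digits of `α`. -/
noncomputable def initSeg (α : ℝ) (n : ℕ) : List Bool := (List.range n).map (binDigit α)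

/-- The digit sequence of `α` as a (total) oracle. -/
noncomputable def digitOracle (α : ℝ) : ℕ →. ℕ := fun k => Part.some (binDigit α k).toNat

/-!
That `C(α_n) > C(n) + d` infinitely often is Chaitin's theorem: if all but finitely many prefixes
`b_n` of a bit sequence `b` satisfy `C(b_n) ≤ C(n) + d`, then `b` is computable. Since
`C(n) ≤ |n| + O(1)`, every `b_n` with `ℓ = 2^i ≤ n < 2ℓ` is the output of one of the first
`O(ℓ)` programs, so `b_ℓ` is the truncation to length `ℓ` of at least `ℓ` of their outputs. Only
boundedly many strings have that property, and they can be enumerated. Once the list for `i` has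
reached the largest size `r` attained for infinitely many `i`, it contains `b_ℓ` for all large `i`;
because the lists are bounded, there is a fixed prefix of `b` such that, for every `n`, infinitely
often a list of this size contains no string that extends the prefix but disagrees with `b_n`.
Searching for such lists computes `b`.

For `C^*(n)`, given `α_n`, wait for a stage `s` at which the enumeration of `α` by `P` has reached
a rational with the first `n` digits of `α`; being nondecreasing, it keeps these digits from then
on. If a shortest program `p` of `n` has not halted by stage `s`, its halting time can replace `s`,
so `P` and `p` together describe `α_n` and `C(α_n) ≤ C(n) + 2|P| + O(1)`. Otherwise `C(n)` is the
length of the first program that has output `n` by stage `s`.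
-/

section Computability

variable {α β σ : Type*} [Primcodable α] [Primcodable β] [Primcodable σ]

theorem exists_partrec_selector {R : α → β → Bool} (hR : Computable₂ R) :
    ∃ f : α →. β, Partrec f ∧ ∀ a, (∃ b, R a b) → ∃ b ∈ f a, R a b := by
  let candidate (a : α) (n : ℕ) : Option β :=
    (Encodable.decode n).bind fun b => bif R a b then some b else none
  have hcandidate : Computable₂ candidate :=
    Computable.option_bind (Computable.decode.comp Computable.snd)
      (Computable.cond (hR.comp (Computable.fst.comp Computable.fst) Computable.snd)
        (Computable.option_some.comp Computable.snd) (Computable.const none))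
  have mem_candidate {a : α} {n : ℕ} {b : β} (h : b ∈ candidate a n) : R a b := by
    simp only [candidate, Option.mem_def, Option.bind_eq_some_iff, Bool.cond_eq_ite,
      Option.ite_none_right_eq_some, Option.some.injEq] at h
    obtain ⟨b, -, hb, rfl⟩ := h
    exact hb
  refine ⟨fun a => Nat.rfindOpt (candidate a), Partrec.rfindOpt hcandidate, fun a ⟨b, hb⟩ => ?_⟩
  have hdom : (Nat.rfindOpt (candidate a)).Dom :=
    Nat.rfindOpt_dom.2 ⟨Encodable.encode b, b, by simp [candidate, hb]⟩
  obtain ⟨c, hc⟩ := Part.dom_iff_mem.1 hdom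
  obtain ⟨n, hn⟩ := Nat.rfindOpt_spec hc
  exact ⟨c, hc, mem_candidate hn⟩

theorem computable_of_search {R : α → β → Bool} (hR : Computable₂ R) {g : β → σ}
    (hg : Computable g) {h : α → σ} (hex : ∀ a, ∃ b, R a b) (heq : ∀ a b, R a b → g b = h a) :
    Computable h := by
  obtain ⟨f, hf, hfR⟩ := exists_partrec_selector hR
  refine (hf.map (hg.comp Computable.snd).to₂).of_eq_tot fun a => ?_
  obtain ⟨b, hb, hab⟩ := hfR a (hex a)
  exact (Part.mem_map_iff g).2 ⟨b, hb, heq a b hab⟩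

/-- `F s a` is the result of running a computation of the partial function `f` on `a` for `s`
steps. -/
structure IsStageApprox (f : α →. σ) (F : ℕ → α → Option σ) : Prop where
  primrec : Primrec₂ F
  mono {s t : ℕ} {a : α} {y : σ} : s ≤ t → y ∈ F s a → y ∈ F t a
  mem_iff {a : α} {y : σ} : y ∈ f a ↔ ∃ s, y ∈ F s a

theorem exists_isStageApprox {f : α →. σ} (hf : Partrec f) :
    ∃ F : ℕ → α → Option σ, IsStageApprox f F := by
  obtain ⟨c, hc⟩ := Nat.Partrec.Code.exists_code.1 hf
  have mem_eval {a : α} {m : ℕ} :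
      m ∈ c.eval (Encodable.encode a) ↔ ∃ y ∈ f a, Encodable.encode y = m := by
    simp [hc]
  refine ⟨fun s a => (c.evaln s (Encodable.encode a)).bind Encodable.decode, ?_, ?_, ?_⟩
  · exact Primrec.option_bind
      (Nat.Partrec.Code.primrec_evaln.comp
        ((Primrec.fst.pair (Primrec.const c)).pair (Primrec.encode.comp Primrec.snd)))
      (Primrec.decode.comp Primrec.snd)
  · intro s t a y hst hy
    obtain ⟨m, hm, hmy⟩ := Option.bind_eq_some_iff.1 hy
    exact Option.bind_eq_some_iff.2 ⟨m, Nat.Partrec.Code.evaln_mono hst hm, hmy⟩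
  · intro a y
    constructor
    · intro hy
      obtain ⟨s, hs⟩ := Nat.Partrec.Code.evaln_complete.1 (mem_eval.2 ⟨y, hy, rfl⟩)
      exact ⟨s, Option.bind_eq_some_iff.2 ⟨_, hs, Encodable.encodek y⟩⟩
    · rintro ⟨s, hs⟩
      obtain ⟨m, hm, hmy⟩ := Option.bind_eq_some_iff.1 hs
      obtain ⟨z, hz, rfl⟩ := mem_eval.1 (Nat.Partrec.Code.evaln_sound hm)
      rw [Encodable.encodek, Option.some_inj] at hmy
      exact hmy ▸ hz

theorem primrec₂_count {R : ℕ → α → Prop} [DecidableRel R] (hR : PrimrecRel R) :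
    Primrec₂ fun (a : α) n => Nat.count (R · a) n :=
  (Primrec.list_length.comp
    (hR.listFilter.comp (Primrec.list_range.comp Primrec.snd) Primrec.fst)).of_eq fun p =>
      (Nat.count_eq_card_filter_range (R · p.1) p.2).symm

theorem primrec₂_pow : Primrec₂ ((· ^ ·) : ℕ → ℕ → ℕ) :=
  Primrec₂.unpaired'.1 Nat.Primrec.pow

theorem computable_of_eventually_eq_const {f : ℕ → σ} {c : σ} (h : ∀ᶠ n in Filter.atTop, f n = c) :
    Computable f := by
  obtain ⟨N, hN⟩ := Filter.eventually_atTop.1 h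
  refine Primrec.to_comp (((Primrec.list_getD c).comp
    (Primrec.const ((List.range N).map f)) Primrec.id).of_eq fun n => ?_)
  rcases lt_or_ge n N with hn | hn
  · simp [hn]
  · simp [hn, hN n hn]

end Computability

section BinaryStrings

theorem strToNat_injective : Function.Injective strToNat :=
  Function.LeftInverse.injective natToStr_strToNat

theorem natToStr_injective : Function.Injective natToStr :=
  Function.LeftInverse.injective strToNat_natToStr

theorem two_pow_length_le_strToNat_succ (x : List Bool) : 2 ^ x.length ≤ strToNat x + 1 := by
  induction x using List.reverseRecOn with
  | nil => simp
  | append_singleton x b ih =>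
    rw [strToNat_append, List.length_append, List.length_singleton, pow_succ]
    omega

theorem strToNat_succ_lt_two_pow (x : List Bool) : strToNat x + 1 < 2 ^ (x.length + 1) := by
  induction x using List.reverseRecOn with
  | nil => simp [strToNat]
  | append_singleton x b ih =>
    rw [strToNat_append, List.length_append, List.length_singleton, pow_succ]
    have := Bool.toNat_le b
    omega

theorem length_le_iff_strToNat {x : List Bool} {n : ℕ} :
    x.length ≤ n ↔ strToNat x + 1 < 2 ^ (n + 1) := by
  constructor
  · exact fun h => (strToNat_succ_lt_two_pow x).trans_le (Nat.pow_le_pow_right two_pos (by omega))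
  · exact fun h => Nat.lt_succ_iff.1 ((Nat.pow_lt_pow_iff_right one_lt_two).1
      ((two_pow_length_le_strToNat_succ x).trans_lt h))

theorem length_le_length_of_strToNat_le {x y : List Bool} (h : strToNat x ≤ strToNat y) :
    x.length ≤ y.length :=
  length_le_iff_strToNat.2 ((Nat.add_le_add_right h 1).trans_lt (strToNat_succ_lt_two_pow y))

theorem primrec_strToNat : Primrec strToNat := by
  have hfold : Primrec fun x : List Bool => x.foldl (fun m b => 2 * m + b.toNat) 1 :=
    Primrec.list_foldl (h := fun _ (p : ℕ × Bool) => 2 * p.1 + p.2.toNat) Primrec.id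
      (Primrec.const 1)
      (Primrec.nat_add.comp (Primrec.nat_double.comp (Primrec.fst.comp Primrec.snd))
        ((Primrec.dom_bool Bool.toNat).comp (Primrec.snd.comp Primrec.snd)))
  exact Primrec.nat_sub.comp hfold (Primrec.const 1)

theorem natToStr_succ (n : ℕ) : natToStr (n + 1) = natToStr (n / 2) ++ [decide (n % 2 = 1)] := by
  rw [← natToStr_bit]
  congr 1
  rcases Nat.mod_two_eq_zero_or_one n with h | h <;> simp [h] <;> omega

theorem primrec_natToStr : Primrec natToStr := by
  let g (l : List (List Bool)) : ℕ → List Bool :=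
    Nat.rec [] fun n _ => l.getD (n / 2) [] ++ [decide (n % 2 = 1)]
  have hbit : Primrec fun n => decide (n % 2 = 1) :=
    (Primrec.eq.comp (Primrec.nat_mod.comp Primrec.id (Primrec.const 2)) (Primrec.const 1)).decide
  have hstep : Primrec₂ fun (l : List (List Bool)) (p : ℕ × List Bool) =>
      l.getD (p.1 / 2) [] ++ [decide (p.1 % 2 = 1)] :=
    Primrec.list_concat.comp
      ((Primrec.list_getD []).comp Primrec.fst
        (Primrec.nat_div.comp (Primrec.fst.comp Primrec.snd) (Primrec.const 2)))
      (hbit.comp (Primrec.fst.comp Primrec.snd))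
  have hg : Primrec fun l : List (List Bool) => g l l.length :=
    Primrec.nat_rec' Primrec.list_length (Primrec.const []) hstep
  refine (Primrec.nat_strong_rec (fun _ : Unit => natToStr) (Primrec.option_some.comp
    (hg.comp Primrec.snd)).to₂ fun _ n => ?_).comp (Primrec.const ()) Primrec.id
  rcases n with _ | n
  · simp [g, natToStr_zero]
  · have hlt : n / 2 < n + 1 := by omega
    simp [g, natToStr_succ, hlt]

end BinaryStrings

section Pairing

/-- The self-delimiting pair `1^|x| 0 x y` of two strings, of length `|y| + 2|x| + 1`. -/
def pairStr (x y : List Bool) : List Bool :=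
  List.replicate x.length true ++ false :: (x ++ y)

/-- The inverse of `pairStr`. -/
def unpairStr (w : List Bool) : List Bool × List Bool :=
  ((w.drop (w.idxOf false + 1)).take (w.idxOf false),
    (w.drop (w.idxOf false + 1)).drop (w.idxOf false))

theorem length_pairStr (x y : List Bool) :
    (pairStr x y).length = y.length + (2 * x.length + 1) := by
  simp only [pairStr, List.length_append, List.length_replicate, List.length_cons]
  ring

theorem idxOf_pairStr (x y : List Bool) : (pairStr x y).idxOf false = x.length := by
  rw [pairStr, List.idxOf_append_of_notMem (by simp)]
  simp

theorem unpairStr_pairStr (x y : List Bool) : unpairStr (pairStr x y) = (x, y) := by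
  have hdrop : (pairStr x y).drop (x.length + 1) = x ++ y := by
    rw [pairStr, List.drop_append]
    simp
  rw [unpairStr, idxOf_pairStr, hdrop, List.take_left, List.drop_left]

theorem primrec_unpairStr : Primrec unpairStr := by
  have hidx : Primrec fun w : List Bool => w.idxOf false :=
    Primrec.list_idxOf.comp (Primrec.const false) Primrec.id
  have hrest : Primrec fun w : List Bool => w.drop (w.idxOf false + 1) :=
    Primrec.list_drop.comp (Primrec.succ.comp hidx) Primrec.id
  exact (Primrec.list_take.comp hidx hrest).pair (Primrec.list_drop.comp hidx hrest)

end Pairing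

section BitPrefix

/-- The string of the first `n` terms of the bit sequence `b`. -/
def bitPrefix (b : ℕ → Bool) (n : ℕ) : List Bool := (List.range n).map b

variable (b : ℕ → Bool)

theorem length_bitPrefix (n : ℕ) : (bitPrefix b n).length = n := by
  simp [bitPrefix]

theorem take_bitPrefix {m n : ℕ} (h : m ≤ n) : (bitPrefix b n).take m = bitPrefix b m := by
  simp [bitPrefix, ← List.map_take, List.take_range, h]

theorem bitPrefix_succ (n : ℕ) : bitPrefix b (n + 1) = bitPrefix b n ++ [b n] := by
  simp [bitPrefix, List.range_succ]

variable {b}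

theorem bitPrefix_eq_bitPrefix_iff {c : ℕ → Bool} {n : ℕ} :
    bitPrefix b n = bitPrefix c n ↔ ∀ k < n, b k = c k := by
  simp [bitPrefix]

theorem computable_of_computable_bitPrefix (h : Computable (bitPrefix b)) : Computable b := by
  refine ((Primrec.list_getD false).to_comp.comp (h.comp Computable.succ) Computable.id).of_eq
    fun n => ?_
  simp [bitPrefix]

end BitPrefix

section Oracle

theorem recursiveIn_natRec {O : Set (ℕ →. ℕ)} {g : ℕ → ℕ}
    (hg : Nat.RecursiveIn O fun k => Part.some (g k)) {step : ℕ → ℕ → ℕ} (hstep : Primrec₂ step)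
    (a : ℕ) :
    Nat.RecursiveIn O fun n => Part.some (Nat.rec a (fun k r => step r (g k)) n : ℕ) := by
  have hindex : Nat.RecursiveIn O fun m => Part.some m.unpair.2.unpair.1 :=
    (Nat.Primrec.left.comp Nat.Primrec.right).recursiveIn
  have hvalue : Nat.RecursiveIn O fun m => Part.some m.unpair.2.unpair.2 :=
    (Nat.Primrec.right.comp Nat.Primrec.right).recursiveIn
  have hstep' : Nat.RecursiveIn O fun m => Part.some (m.unpaired step) :=
    (Primrec₂.unpaired'.2 hstep).recursiveIn
  have hrec := Nat.RecursiveIn.comp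
    (Nat.RecursiveIn.prec (Nat.Primrec.const a).recursiveIn
      (hstep'.comp (hvalue.pair (hg.comp hindex))))
    (Nat.RecursiveIn.pair .zero Nat.Primrec.id.recursiveIn)
  refine hrec.of_eq fun n => ?_
  have hzero : (0 : Part ℕ) = Part.some 0 := rfl
  simp only [hzero, Seq.seq, Part.bind_eq_bind, Part.map_eq_map, Part.map_some, Part.bind_some,
    Part.coe_some, Nat.unpair_pair, Nat.unpaired, id]
  induction n with
  | zero => rfl
  | succ n ih => simp only [ih, Part.bind_some]

theorem recursiveIn_strToNat_bitPrefix {O : Set (ℕ →. ℕ)} {b : ℕ → Bool}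
    (hb : Nat.RecursiveIn O fun k => Part.some (b k).toNat) :
    Nat.RecursiveIn O fun n => Part.some (strToNat (bitPrefix b n)) := by
  have hstep : Primrec₂ fun r k : ℕ => 2 * r + 1 + k :=
    Primrec.nat_add.comp (Primrec.nat_double_succ.comp Primrec.fst) Primrec.snd
  refine (recursiveIn_natRec hb hstep 0).of_eq fun n => congrArg Part.some ?_
  induction n with
  | zero => rfl
  | succ n ih => rw [bitPrefix_succ, strToNat_append, ← ih]

theorem turingReducible_of_partrec_bitPrefix {f : ℕ × List Bool →. ℕ} (hf : Partrec f)
    (b : ℕ → Bool) :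
    TuringReducible (fun n => f (n, bitPrefix b n)) fun k => Part.some (b k).toNat := by
  refine RecursiveIn.iff_nat.2 ?_
  have hprefix := recursiveIn_strToNat_bitPrefix (Nat.RecursiveIn.oracle _ rfl)
    (O := {fun k => Part.some (b k).toNat})
  have hf' : Partrec₂ fun n m => f (n, natToStr m) :=
    hf.comp (Computable.fst.pair (primrec_natToStr.to_comp.comp Computable.snd))
  refine ((Partrec₂.unpaired'.2 hf').recursiveIn.comp
    (Nat.Primrec.id.recursiveIn.pair hprefix)).of_eq fun n => ?_
  simp [Seq.seq, Nat.unpaired, natToStr_strToNat]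

end Oracle

section BinaryDigits

theorem floor_two_pow_succ_mul (x : ℝ) (k : ℕ) :
    ⌊(2 : ℝ) ^ (k + 1) * x⌋ = 2 * ⌊(2 : ℝ) ^ k * x⌋ + (binDigit x k).toNat := by
  have hhalf : ⌊(2 : ℝ) ^ k * x⌋ = ⌊(2 : ℝ) ^ (k + 1) * x⌋ / 2 := by
    have hdiv : (2 : ℝ) ^ k * x = 2 ^ (k + 1) * x / (2 : ℕ) := by
      rw [pow_succ]
      push_cast
      ring
    rw [hdiv, Int.floor_div_natCast, Nat.cast_ofNat]
  rcases Int.emod_two_eq_zero_or_one ⌊(2 : ℝ) ^ (k + 1) * x⌋ with h | h <;>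
    simp only [binDigit, h, hhalf] <;> simp <;> omega

theorem initSeg_eq_bitPrefix (x : ℝ) (n : ℕ) : initSeg x n = bitPrefix (binDigit x) n := rfl

theorem floor_two_pow_mul_eq_iff {x y : ℝ} {n : ℕ} :
    ⌊(2 : ℝ) ^ n * x⌋ = ⌊(2 : ℝ) ^ n * y⌋ ↔ ⌊x⌋ = ⌊y⌋ ∧ initSeg x n = initSeg y n := by
  induction n with
  | zero => simp [initSeg]
  | succ n ih =>
    have hsplit : initSeg x (n + 1) = initSeg y (n + 1) ↔
        initSeg x n = initSeg y n ∧ binDigit x n = binDigit y n := by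
      simp only [initSeg_eq_bitPrefix, bitPrefix_eq_bitPrefix_iff, Nat.forall_lt_succ_right]
    rw [hsplit, ← and_assoc, ← ih, floor_two_pow_succ_mul, floor_two_pow_succ_mul]
    generalize ⌊(2 : ℝ) ^ n * x⌋ = i, ⌊(2 : ℝ) ^ n * y⌋ = j
    cases binDigit x n <;> cases binDigit y n <;> simp <;> omega

theorem initSeg_eq_of_le_of_le {x y z : ℝ} {n : ℕ} (hxy : x ≤ y) (hyz : y ≤ z)
    (hfloor : ⌊x⌋ = ⌊z⌋) (hxz : initSeg x n = initSeg z n) : initSeg y n = initSeg z n := by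
  have hends : ⌊(2 : ℝ) ^ n * x⌋ = ⌊(2 : ℝ) ^ n * z⌋ :=
    floor_two_pow_mul_eq_iff.2 ⟨hfloor, hxz⟩
  have hle : ⌊(2 : ℝ) ^ n * y⌋ ≤ ⌊(2 : ℝ) ^ n * z⌋ := by gcongr
  have hge : ⌊(2 : ℝ) ^ n * x⌋ ≤ ⌊(2 : ℝ) ^ n * y⌋ := by gcongr
  exact (floor_two_pow_mul_eq_iff.1 (le_antisymm hle (hends ▸ hge))).2

theorem binDigit_sub_natCast (x : ℝ) (m k : ℕ) : binDigit (x - m) k = binDigit x k := by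
  have hshift : (2 : ℝ) ^ (k + 1) * (x - m) = 2 ^ (k + 1) * x - (2 * (2 ^ k * m) : ℕ) := by
    push_cast
    ring
  have hparity (z : ℤ) (j : ℕ) : (z - (2 * j : ℕ)) % 2 = z % 2 := by omega
  simp only [binDigit, hshift, Int.floor_sub_natCast, hparity]

theorem binDigit_natCast_div (a c k : ℕ) :
    binDigit ((a : ℝ) / c) k = decide (2 ^ (k + 1) * a / c % 2 = 1) := by
  have hfloor : ⌊(2 : ℝ) ^ (k + 1) * (a / c)⌋ = (2 ^ (k + 1) * a / c : ℕ) := by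
    rw [← Nat.floor_div_eq_div (K := ℝ), Int.natCast_floor_eq_floor (by positivity), mul_div_assoc']
    push_cast
    rfl
  simp only [binDigit, hfloor]
  norm_cast

theorem natToRat_eq_div_sub (m : ℕ) :
    (natToRat m : ℝ) =
      ((m.unpair.1.unpair.1 + m.unpair.1.unpair.2 * m.unpair.2 : ℕ) : ℝ) / (m.unpair.2 + 1 : ℕ) -
        (m.unpair.1.unpair.2 : ℕ) := by
  have hne : (m.unpair.2 : ℝ) + 1 ≠ 0 := by positivity
  rw [natToRat]
  push_cast
  field_simp
  ring

theorem primrec₂_initSeg_natToRat : Primrec₂ fun m n => initSeg (natToRat m) n := by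
  let numerator (m : ℕ) : ℕ := m.unpair.1.unpair.1 + m.unpair.1.unpair.2 * m.unpair.2
  have hdenominator : Primrec fun m : ℕ => m.unpair.2 := Primrec.snd.comp Primrec.unpair
  have hdifference : Primrec fun m : ℕ => m.unpair.1.unpair :=
    Primrec.unpair.comp (Primrec.fst.comp Primrec.unpair)
  have hnumerator : Primrec numerator :=
    Primrec.nat_add.comp (Primrec.fst.comp hdifference)
      (Primrec.nat_mul.comp (Primrec.snd.comp hdifference) hdenominator)
  have hbit : PrimrecRel fun m k : ℕ => 2 ^ (k + 1) * numerator m / (m.unpair.2 + 1) % 2 = 1 :=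
    Primrec.eq.comp (Primrec.nat_mod.comp (Primrec.nat_div.comp
      (Primrec.nat_mul.comp
        (primrec₂_pow.comp (Primrec.const 2) (Primrec.succ.comp Primrec.snd))
        (hnumerator.comp Primrec.fst))
      (Primrec.succ.comp (hdenominator.comp Primrec.fst))) (Primrec.const 2)) (Primrec.const 1)
  refine (Primrec.list_map (Primrec.list_range.comp Primrec.snd)
    (hbit.decide.comp (Primrec.fst.comp Primrec.fst) Primrec.snd).to₂).of_eq fun p => ?_
  refine List.map_congr_left fun k _ => ?_
  rw [natToRat_eq_div_sub, binDigit_sub_natCast, binDigit_natCast_div]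

theorem two_pow_mul_ne_intCast {x : ℝ} (hx : ¬ Computable (binDigit x)) (n : ℕ) (z : ℤ) :
    (2 : ℝ) ^ n * x ≠ z := by
  intro hz
  refine hx (computable_of_eventually_eq_const (c := false) ?_)
  filter_upwards [Filter.eventually_ge_atTop n] with k hk
  obtain ⟨j, rfl⟩ := Nat.exists_eq_add_of_le hk
  have heven : (2 : ℝ) ^ (n + j + 1) * x = (2 * (2 ^ j * z) : ℤ) := by
    push_cast
    rw [← hz]
    ring
  simp only [binDigit, heven, Int.floor_intCast, Int.mul_emod_right, zero_ne_one, decide_false]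

theorem eventually_floor_eq {ι : Type*} {l : Filter ι} {u : ι → ℝ} {x : ℝ}
    (hu : Filter.Tendsto u l (nhds x)) (hx : ∀ z : ℤ, x ≠ z) : ∀ᶠ i in l, ⌊u i⌋ = ⌊x⌋ := by
  have hlt : (⌊x⌋ : ℝ) < x := (Int.floor_le x).lt_of_ne (hx _).symm
  filter_upwards [hu (Ioo_mem_nhds hlt (Int.lt_floor_add_one x))] with i hi
  exact Int.floor_eq_iff.2 ⟨hi.1.le, hi.2⟩

theorem eventually_initSeg_eq {ι : Type*} {l : Filter ι} {u : ι → ℝ} {x : ℝ}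
    (hu : Filter.Tendsto u l (nhds x)) (hx : ¬ Computable (binDigit x)) (n : ℕ) :
    ∀ᶠ i in l, ⌊u i⌋ = ⌊x⌋ ∧ initSeg (u i) n = initSeg x n := by
  filter_upwards [eventually_floor_eq (hu.const_mul ((2 : ℝ) ^ n)) (two_pow_mul_ne_intCast hx n)]
    with i hi
  exact floor_two_pow_mul_eq_iff.1 hi

theorem exists_forall_initSeg_eq_of_le {u : ℕ → ℝ} {x : ℝ} (hmono : Monotone u)
    (hlim : Filter.Tendsto u Filter.atTop (nhds x)) (hx : ¬ Computable (binDigit x)) :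
    ∃ s₀, ∀ n, ∀ s ≥ s₀, ∀ t ≥ s,
      initSeg (u s) n = initSeg x n → initSeg (u t) n = initSeg x n := by
  obtain ⟨s₀, hs₀⟩ := Filter.eventually_atTop.1 (eventually_initSeg_eq hlim hx 0)
  exact ⟨s₀, fun n s hs t hst hsn =>
    initSeg_eq_of_le_of_le (hmono hst) (hmono.ge_of_tendsto hlim t) (hs₀ s hs).1 hsn⟩

end BinaryDigits

section ShortDescriptions

variable {b : ℕ → Bool}

theorem exists_frequently_isolates {ι : Type*} {l : Filter ι} [l.NeBot]
    {S : ι → Finset (List Bool)} {w : ℕ} (hS : ∀ i, (S i).card ≤ w) (b : ℕ → Bool) :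
    ∃ m, ∀ n, ∃ᶠ i in l, ∀ x ∈ S i, x.take m = bitPrefix b m → x.take n = bitPrefix b n := by
  by_contra! hnot
  have hdeviating (k : ℕ) :
      ∃ m, ∀ᶠ i in l, k ≤ ((S i).filter fun x => x.take m ≠ bitPrefix b m).card := by
    induction k with
    | zero => exact ⟨0, .of_forall fun _ => Nat.zero_le _⟩
    | succ k ih =>
      obtain ⟨m, hm⟩ := ih
      obtain ⟨n, hn⟩ := hnot m
      have take_ne {j : ℕ} (hj : j ≤ max m n) {x : List Bool} (hx : x.take j ≠ bitPrefix b j) :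
          x.take (max m n) ≠ bitPrefix b (max m n) := fun heq => hx <| by
        rw [← take_bitPrefix b hj, ← heq, List.take_take, min_eq_left hj]
      refine ⟨max m n, ?_⟩
      filter_upwards [hm, hn] with i hcard ⟨x, hxS, hxm, hxn⟩
      refine hcard.trans_lt (Finset.card_lt_card ((Finset.ssubset_iff_of_subset ?_).2 ⟨x, ?_, ?_⟩))
      · exact Finset.monotone_filter_right _ fun y _ hy => take_ne (le_max_left m n) hy
      · exact Finset.mem_filter.2 ⟨hxS, take_ne (le_max_right m n) hxn⟩
      · simp [hxm]
  obtain ⟨m, hm⟩ := hdeviating (w + 1)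
  obtain ⟨i, hi⟩ := hm.exists
  exact absurd (hi.trans (Finset.card_filter_le _ _)) (not_le.2 (Nat.lt_succ_of_le (hS i)))

theorem computable_of_isolating_lists {γ : Type*} [Primcodable γ] {K : γ → List (List Bool)}
    (hK : Primrec K) {R : ℕ → γ → Prop} (hR : PrimrecRel R) {m : ℕ}
    (hmem : ∀ n c, R n c → ∃ N ≥ max m n, bitPrefix b N ∈ K c)
    (hisolates : ∀ n, ∃ c, R n c ∧
      ∀ x ∈ K c, x.take m = bitPrefix b m → x.take n = bitPrefix b n) : Computable b := by
  let forces (n : ℕ) (p : List Bool × γ) : Prop :=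
    R n p.2 ∧ ∀ x ∈ K p.2, x.take m = bitPrefix b m → x.take n = p.1
  have hagree : PrimrecRel fun (x : List Bool) (q : ℕ × List Bool × γ) =>
      x.take m = bitPrefix b m → x.take q.1 = q.2.1 :=
    ((Primrec.eq.comp (Primrec.list_take.comp (Primrec.const m) Primrec.fst)
      (Primrec.const (bitPrefix b m))).not.or
      (Primrec.eq.comp (Primrec.list_take.comp (Primrec.fst.comp Primrec.snd) Primrec.fst)
        (Primrec.fst.comp (Primrec.snd.comp Primrec.snd)))).of_eq fun _ => imp_iff_not_or.symm
  have hforces : PrimrecRel forces :=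
    (hR.comp Primrec.fst (Primrec.snd.comp Primrec.snd)).and
      (hagree.forall_mem_list.comp (hK.comp (Primrec.snd.comp Primrec.snd)) Primrec.id)
  classical
  refine computable_of_computable_bitPrefix
    (computable_of_search hforces.decide.to_comp Computable.fst (fun n => ?_) fun n p hp => ?_)
  · obtain ⟨c, hc, hkeep⟩ := hisolates n
    exact ⟨(bitPrefix b n, c), decide_eq_true ⟨hc, hkeep⟩⟩
  · obtain ⟨hp, hkeep⟩ := of_decide_eq_true hp
    obtain ⟨N, hN, hmemN⟩ := hmem n p.2 hp
    rw [← hkeep _ hmemN (take_bitPrefix b ((le_max_left m n).trans hN)),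
      take_bitPrefix b ((le_max_right m n).trans hN)]

section GrowingLists

variable {L : ℕ → ℕ → List (List Bool)}

theorem exists_frequent_length_forcing_mem (hnodup : ∀ i s, (L i s).Nodup)
    (hmono : ∀ i {s t}, s ≤ t → L i s ⊆ L i t) {w : ℕ} (hw : ∀ i s, (L i s).length ≤ w)
    (hb : ∀ᶠ i in Filter.atTop, ∃ n ≥ i, ∃ s, bitPrefix b n ∈ L i s) :
    ∃ r, (∃ᶠ i in Filter.atTop, ∃ s, r ≤ (L i s).length) ∧
      ∀ᶠ i in Filter.atTop, ∀ s, r ≤ (L i s).length → ∃ n ≥ i, bitPrefix b n ∈ L i s := by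
  -- A list of the largest size reached infinitely often grows no further.
  obtain ⟨r, hr, hr'⟩ : ∃ r, ¬¬ (∃ᶠ i in Filter.atTop, ∃ s, r ≤ (L i s).length) ∧
      ¬ ∃ᶠ i in Filter.atTop, ∃ s, r + 1 ≤ (L i s).length := by
    refine Nat.exists_not_and_succ_of_not_zero_of_exists
      (not_not.2 (Filter.Frequently.of_forall fun _ => ⟨0, Nat.zero_le _⟩)) ⟨w + 1, ?_⟩
    exact Filter.not_frequently.2
      (.of_forall fun i ⟨s, hs⟩ => Nat.not_succ_le_self w (hs.trans (hw i s)))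
  refine ⟨r, not_not.1 hr, ?_⟩
  filter_upwards [Filter.not_frequently.1 hr', hb] with i hi ⟨n, hn, t, ht⟩ s hs
  refine ⟨n, hn, by_contra fun hmem => hi ⟨max s t, ?_⟩⟩
  have hsub : bitPrefix b n :: L i s ⊆ L i (max s t) :=
    List.cons_subset.2 ⟨hmono i (le_max_right s t) ht, hmono i (le_max_left s t)⟩
  have hnodup' : (bitPrefix b n :: L i s).Nodup := List.nodup_cons.2 ⟨hmem, hnodup i s⟩
  exact (Nat.succ_le_succ hs).trans (hnodup'.subperm hsub).length_le

theorem computable_of_eventually_mem_lists (hL : Primrec₂ L) (hnodup : ∀ i s, (L i s).Nodup)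
    (hmono : ∀ i {s t}, s ≤ t → L i s ⊆ L i t) {w : ℕ} (hw : ∀ i s, (L i s).length ≤ w)
    (hb : ∀ᶠ i in Filter.atTop, ∃ n ≥ i, ∃ s, bitPrefix b n ∈ L i s) : Computable b := by
  obtain ⟨r, hr, hforces⟩ := exists_frequent_length_forcing_mem hnodup hmono hw hb
  obtain ⟨i₀, hi₀⟩ := Filter.eventually_atTop.1 hforces
  obtain ⟨φ, hφ, hreached⟩ := Filter.extraction_of_frequently_atTop hr
  choose s hs using hreached
  obtain ⟨m, hm⟩ := exists_frequently_isolates (l := Filter.atTop)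
    (S := fun k => (L (φ k) (s k)).toFinset)
    (fun k => (List.toFinset_card_le _).trans (hw (φ k) (s k))) b
  have hL' : Primrec fun p : ℕ × ℕ => L p.1 p.2 := hL
  refine computable_of_isolating_lists (m := m) hL'
    (R := fun n p => max i₀ (max m n) ≤ p.1 ∧ r ≤ (L p.1 p.2).length) ?_ ?_ ?_
  · exact (Primrec.nat_le.comp (Primrec.nat_max.comp (Primrec.const i₀)
      (Primrec.nat_max.comp (Primrec.const m) Primrec.fst)) (Primrec.fst.comp Primrec.snd)).and
      (Primrec.nat_le.comp (Primrec.const r)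
        (Primrec.list_length.comp (hL'.comp Primrec.snd)))
  · rintro n ⟨i, t⟩ ⟨hi, ht⟩
    obtain ⟨N, hN, hmem⟩ := hi₀ i ((le_max_left _ _).trans hi) t ht
    exact ⟨N, ((le_max_right _ _).trans hi).trans hN, hmem⟩
  · intro n
    obtain ⟨k, hkeep, hk⟩ :=
      ((hm n).and_eventually (Filter.eventually_ge_atTop (max i₀ (max m n)))).exists
    exact ⟨(φ k, s k), ⟨hk.trans hφ.le_apply, hs k⟩, fun x hx =>
      hkeep x (List.mem_toFinset.2 hx)⟩

end GrowingLists

section HeavyPrefixes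

/-- The strings of length at most `ℓ` that are the truncation to length `ℓ` of the outputs of at
least `ℓ` of the first `N` programs, at stage `s` of the approximation `F` of a machine. -/
def heavyPrefixes (F : ℕ → List Bool → Option (List Bool)) (ℓ N s : ℕ) : List (List Bool) :=
  ((List.range (2 ^ (ℓ + 1) - 1)).map natToStr).filter fun x =>
    ℓ ≤ Nat.count (fun k => (F s (natToStr k)).map (List.take ℓ) = some x) N

variable {F : ℕ → List Bool → Option (List Bool)} {V : List Bool →. List Bool}

theorem mem_heavyPrefixes {ℓ N s : ℕ} {x : List Bool} :
    x ∈ heavyPrefixes F ℓ N s ↔ x.length ≤ ℓ ∧ ℓ ≤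
      ((Finset.range N).filter fun k => (F s (natToStr k)).map (List.take ℓ) = some x).card := by
  have hstrings : x ∈ (List.range (2 ^ (ℓ + 1) - 1)).map natToStr ↔ x.length ≤ ℓ := by
    rw [length_le_iff_strToNat, ← Nat.lt_sub_iff_add_lt, List.mem_map]
    constructor
    · rintro ⟨k, hk, rfl⟩
      rwa [strToNat_natToStr, ← List.mem_range]
    · exact fun h => ⟨strToNat x, List.mem_range.2 h, natToStr_strToNat x⟩
  rw [heavyPrefixes, List.mem_filter, hstrings, decide_eq_true_iff, Nat.count_eq_card_filter_range]

theorem nodup_heavyPrefixes (F : ℕ → List Bool → Option (List Bool)) (ℓ N s : ℕ) :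
    (heavyPrefixes F ℓ N s).Nodup :=
  (List.nodup_range.map natToStr_injective).filter _

theorem IsStageApprox.heavyPrefixes_subset (hF : IsStageApprox V F) (ℓ N : ℕ) {s t : ℕ}
    (hst : s ≤ t) : heavyPrefixes F ℓ N s ⊆ heavyPrefixes F ℓ N t := by
  intro x hx
  obtain ⟨hlength, hcard⟩ := mem_heavyPrefixes.1 hx
  refine mem_heavyPrefixes.2 ⟨hlength, hcard.trans (Finset.card_le_card ?_)⟩
  refine Finset.monotone_filter_right _ fun k _ hk => ?_
  obtain ⟨y, hy, hyx⟩ := Option.map_eq_some_iff.1 hk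
  exact Option.map_eq_some_iff.2 ⟨y, hF.mono hst hy, hyx⟩

theorem length_heavyPrefixes_mul_le (F : ℕ → List Bool → Option (List Bool)) (ℓ N s : ℕ) :
    (heavyPrefixes F ℓ N s).length * ℓ ≤ N := by
  let truncated (k : ℕ) : Option (List Bool) := (F s (natToStr k)).map (List.take ℓ)
  let heavy : Finset (Option (List Bool)) := ((heavyPrefixes F ℓ N s).map some).toFinset
  have hcard : heavy.card = (heavyPrefixes F ℓ N s).length := by
    rw [List.toFinset_card_of_nodup
      ((nodup_heavyPrefixes F ℓ N s).map (Option.some_injective _)), List.length_map]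
  calc (heavyPrefixes F ℓ N s).length * ℓ
      ≤ ∑ x ∈ heavy, ((Finset.range N).filter fun k => truncated k = x).card := by
        rw [← hcard, ← smul_eq_mul]
        refine Finset.card_nsmul_le_sum _ _ _ fun x hx => ?_
        obtain ⟨y, hy, rfl⟩ := List.mem_map.1 (List.mem_toFinset.1 hx)
        exact (mem_heavyPrefixes.1 hy).2
    _ = ((Finset.range N).filter fun k => truncated k ∈ heavy).card :=
        Finset.sum_card_fiberwise_eq_card_filter _ _ _
    _ ≤ N := (Finset.card_filter_le _ _).trans (Finset.card_range N).le

theorem IsStageApprox.exists_bitPrefix_mem_heavyPrefixes (hF : IsStageApprox V F) {ℓ N : ℕ}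
    (h : ∀ n ∈ Finset.Ico ℓ (2 * ℓ), ∃ p, bitPrefix b n ∈ V p ∧ strToNat p < N) :
    ∃ s, bitPrefix b ℓ ∈ heavyPrefixes F ℓ N s := by
  choose! p hp hpN using h
  have hstage : ∀ᶠ s in Filter.atTop, ∀ n ∈ Finset.Ico ℓ (2 * ℓ), bitPrefix b n ∈ F s (p n) := by
    refine (Filter.eventually_all_finset _).2 fun n hn => ?_
    obtain ⟨s, hs⟩ := hF.mem_iff.1 (hp n hn)
    exact Filter.eventually_atTop.2 ⟨s, fun t hst => hF.mono hst hs⟩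
  obtain ⟨s, hs⟩ := hstage.exists
  refine ⟨s, mem_heavyPrefixes.2 ⟨(length_bitPrefix b ℓ).le, ?_⟩⟩
  have hinj : Set.InjOn (fun n => strToNat (p n)) (Finset.Ico ℓ (2 * ℓ)) := by
    intro m hm n hn hmn
    have hout := hs m hm
    rw [strToNat_injective hmn] at hout
    rw [← length_bitPrefix b m, Option.mem_unique hout (hs n hn), length_bitPrefix]
  calc ℓ = ((Finset.Ico ℓ (2 * ℓ)).image fun n => strToNat (p n)).card := by
        rw [Finset.card_image_of_injOn hinj, Nat.card_Ico]
        omega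
    _ ≤ _ := Finset.card_le_card fun k hk => by
        obtain ⟨n, hn, rfl⟩ := Finset.mem_image.1 hk
        have hout : F s (p n) = some (bitPrefix b n) := hs n hn
        refine Finset.mem_filter.2 ⟨Finset.mem_range.2 (hpN n hn), ?_⟩
        rw [natToStr_strToNat, hout, Option.map_some,
          take_bitPrefix b (Finset.mem_Ico.1 hn).1]

theorem primrec_heavyPrefixes (hF : Primrec₂ F) :
    Primrec fun q : ℕ × ℕ × ℕ => heavyPrefixes F q.1 q.2.1 q.2.2 := by
  have houtputs : PrimrecRel fun (k : ℕ) (q : List Bool × ℕ × ℕ × ℕ) =>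
      (F q.2.2.2 (natToStr k)).map (List.take q.2.1) = some q.1 :=
    Primrec.eq.comp
      (Primrec.option_map
        (hF.comp (Primrec.snd.comp (Primrec.snd.comp (Primrec.snd.comp Primrec.snd)))
          (primrec_natToStr.comp Primrec.fst))
        (Primrec.list_take.comp
          (Primrec.fst.comp (Primrec.snd.comp (Primrec.snd.comp Primrec.fst))) Primrec.snd))
      (Primrec.option_some.comp (Primrec.fst.comp Primrec.snd))
  have hheavy : PrimrecRel fun (x : List Bool) (q : ℕ × ℕ × ℕ) =>
      q.1 ≤ Nat.count (fun k => (F q.2.2 (natToStr k)).map (List.take q.1) = some x) q.2.1 :=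
    Primrec.nat_le.comp (Primrec.fst.comp Primrec.snd)
      ((primrec₂_count houtputs).comp Primrec.id
        (Primrec.fst.comp (Primrec.snd.comp Primrec.snd)))
  have hstrings : Primrec fun q : ℕ × ℕ × ℕ => (List.range (2 ^ (q.1 + 1) - 1)).map natToStr :=
    Primrec.list_map
      (Primrec.list_range.comp (Primrec.nat_sub.comp
        (primrec₂_pow.comp (Primrec.const 2) (Primrec.succ.comp Primrec.fst)) (Primrec.const 1)))
      (primrec_natToStr.comp Primrec.snd)
  exact hheavy.listFilter.comp hstrings Primrec.id

theorem computable_of_short_descriptions (hV : Partrec V) {d : ℕ}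
    (h : ∀ᶠ n in Filter.atTop, ∃ p, bitPrefix b n ∈ V p ∧ p.length ≤ (natToStr n).length + d) :
    Computable b := by
  obtain ⟨F, hF⟩ := exists_isStageApprox hV
  let L (i s : ℕ) : List (List Bool) := heavyPrefixes F (2 ^ i) (2 ^ (i + (d + 2))) s
  have hpow (c : ℕ) : Primrec fun q : ℕ × ℕ => 2 ^ (q.1 + c) :=
    primrec₂_pow.comp (Primrec.const 2) (Primrec.nat_add.comp Primrec.fst (Primrec.const c))
  have hL : Primrec₂ L :=
    (primrec_heavyPrefixes hF.primrec).comp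
      ((hpow 0).pair ((hpow (d + 2)).pair Primrec.snd))
  have hlength (i s : ℕ) : (L i s).length ≤ 2 ^ (d + 2) := by
    refine Nat.le_of_mul_le_mul_right ?_ (Nat.two_pow_pos i)
    rw [← pow_add, add_comm (d + 2)]
    exact length_heavyPrefixes_mul_le F (2 ^ i) (2 ^ (i + (d + 2))) s
  refine computable_of_eventually_mem_lists hL (fun i s => nodup_heavyPrefixes F _ _ s)
    (fun i _ _ hst => hF.heavyPrefixes_subset _ _ hst) hlength ?_
  obtain ⟨n₀, hn₀⟩ := Filter.eventually_atTop.1 h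
  filter_upwards [Filter.eventually_ge_atTop n₀] with i hi
  refine ⟨2 ^ i, Nat.lt_two_pow_self.le, hF.exists_bitPrefix_mem_heavyPrefixes fun n hn => ?_⟩
  obtain ⟨hin, hni⟩ := Finset.mem_Ico.1 hn
  obtain ⟨p, hp, hlen⟩ := hn₀ n (hi.trans (Nat.lt_two_pow_self.le.trans hin))
  have hlen_n : (natToStr n).length ≤ i + 1 := by
    rw [length_le_iff_strToNat, strToNat_natToStr, pow_succ]
    omega
  have hlen_p : p.length ≤ i + (d + 1) := by omega
  exact ⟨p, hp, (Nat.lt_succ_self _).trans (length_le_iff_strToNat.1 hlen_p)⟩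

end HeavyPrefixes

end ShortDescriptions

section Complexity

variable {U : Machine}

theorem complexity_le {x p : List Bool} (h : x ∈ U [] p) : complexity U x ≤ p.length :=
  Nat.sInf_le ⟨p, rfl, h⟩

theorem IsUniversalOptimal.exists_complexity_le (hU : IsUniversalOptimal U) {V : Machine}
    (hV : Partrec₂ V) : ∃ c, ∀ x p, x ∈ V [] p → complexity U x ≤ p.length + c := by
  obtain ⟨c, hc⟩ := hU.optimal V hV
  refine ⟨c, fun x p hx => ?_⟩
  obtain ⟨q, hq, hqp⟩ := hc x [] p hx
  exact (complexity_le hq).trans hqp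

theorem IsUniversalOptimal.exists_complexity_le_length (hU : IsUniversalOptimal U) :
    ∃ c, ∀ x, complexity U x ≤ x.length + c := by
  obtain ⟨c, hc⟩ := hU.exists_complexity_le (V := fun _ p => Part.some p) Computable.snd.partrec
  exact ⟨c, fun x => hc x x (Part.mem_some x)⟩

theorem IsUniversalOptimal.exists_shortest (hU : IsUniversalOptimal U) (x : List Bool) :
    ∃ p, x ∈ U [] p ∧ p.length = complexity U x := by
  obtain ⟨p, hp⟩ := hU.universal (fun _ => Part.some x) (Computable.const x).partrec
  have hx : x ∈ U [] p := hp [] ▸ Part.mem_some x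
  obtain ⟨q, hlen, hq⟩ :=
    Nat.sInf_mem (s := {l | ∃ p : List Bool, p.length = l ∧ x ∈ U [] p}) ⟨_, p, rfl, hx⟩
  exact ⟨q, hq, hlen⟩

theorem IsUniversalOptimal.infinite_setOf_complexity_bitPrefix_gt (hU : IsUniversalOptimal U)
    {b : ℕ → Bool} (hb : ¬ Computable b) (d : ℕ) :
    {n | complexity U (bitPrefix b n) > natComplexity U n + d}.Infinite := by
  rw [← Nat.frequently_atTop_iff_infinite]
  refine fun hfew => hb ?_
  obtain ⟨c, hc⟩ := hU.exists_complexity_le_length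
  have hU₀ : Partrec (U []) := hU.partrec.comp (Computable.const []) Computable.id
  refine computable_of_short_descriptions hU₀ (d := c + d) ?_
  filter_upwards [hfew] with n hn
  obtain ⟨p, hp, hlen⟩ := hU.exists_shortest (bitPrefix b n)
  have hcn : natComplexity U n ≤ (natToStr n).length + c := hc (natToStr n)
  exact ⟨p, hp, by omega⟩

end Complexity

section Enumerations

variable {U : Machine}

theorem IsUniversalOptimal.exists_enumerates (hU : IsUniversalOptimal U) {α : ℝ}
    (hα : IsLeftCE α) : ∃ P, Enumerates U P α := by
  obtain ⟨q, hq, hmono, hlim⟩ := hα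
  have hf : Computable fun y => natToStr (q (strToNat y)) :=
    primrec_natToStr.to_comp.comp (hq.comp primrec_strToNat.to_comp)
  obtain ⟨P, hP⟩ := hU.universal _ hf.partrec
  refine ⟨P, q, fun s => ?_, hmono, hlim⟩
  simp [hP, strToNat_natToStr]

theorem computable_of_mem_natToStr (hU : Partrec₂ U) {P : List Bool} {q : ℕ → ℕ}
    (hq : ∀ s, natToStr (q s) ∈ U (natToStr s) P) : Computable q := by
  have hf : Partrec fun s => (U (natToStr s) P).map strToNat :=
    (hU.comp primrec_natToStr.to_comp (Computable.const P)).map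
      (primrec_strToNat.to_comp.comp Computable.snd)
  exact hf.of_eq_tot fun s => (Part.mem_map_iff _).2 ⟨_, hq s, strToNat_natToStr _⟩

end Enumerations

section HaltingTime

variable {U : Machine} {F : ℕ → List Bool → Option (List Bool)}

theorem exists_machine_of_late_halting (hU : Partrec₂ U) (hF : IsStageApprox (U []) F) :
    ∃ V : Machine, Partrec₂ V ∧ ∀ {P p v : List Bool} {q : ℕ → ℕ} {n t : ℕ},
      (∀ s, natToStr (q s) ∈ U (natToStr s) P) → (∀ s ≥ t, initSeg (natToRat (q s)) n = v) →
      natToStr n ∈ U [] p → natToStr n ∉ F t p → v ∈ V [] (pairStr P p) := by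
  have hhalts : PrimrecRel fun (p : List Bool) (c : ℕ × List Bool) => F c.1 p = some c.2 :=
    Primrec.eq.comp (hF.primrec.comp (Primrec.fst.comp Primrec.snd) Primrec.fst)
      (Primrec.option_some.comp (Primrec.snd.comp Primrec.snd))
  obtain ⟨g, hg, hgF⟩ := exists_partrec_selector hhalts.decide.to_comp
  refine ⟨fun _ w => (g (unpairStr w).2).bind fun c => (U (natToStr c.1) (unpairStr w).1).map
    fun r => initSeg (natToRat (strToNat r)) (strToNat c.2), ?_, ?_⟩
  · refine Partrec.bind (hg.comp (Computable.snd.comp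
      (primrec_unpairStr.to_comp.comp Computable.snd))) (Partrec.map ?_ ?_)
    · exact hU.comp (primrec_natToStr.to_comp.comp (Computable.fst.comp Computable.snd))
        (Computable.fst.comp (primrec_unpairStr.to_comp.comp
          (Computable.snd.comp Computable.fst)))
    · exact primrec₂_initSeg_natToRat.to_comp.comp
        (primrec_strToNat.to_comp.comp Computable.snd)
        (primrec_strToNat.to_comp.comp
          (Computable.snd.comp (Computable.snd.comp Computable.fst)))
  · intro P p v q n t hq hv hn hlate
    obtain ⟨s', hs'⟩ := hF.mem_iff.1 hn
    obtain ⟨⟨s, x⟩, hc, hsx⟩ := hgF p ⟨(s', natToStr n), decide_eq_true hs'⟩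
    have hs : x ∈ F s p := of_decide_eq_true hsx
    obtain rfl : x = natToStr n := Part.mem_unique (hF.mem_iff.2 ⟨s, hs⟩) hn
    have hts : t ≤ s := le_of_not_ge fun hst => hlate (hF.mono hst hs)
    simp only [unpairStr_pairStr]
    refine Part.mem_bind hc ((Part.mem_map_iff _).2 ⟨_, hq s, ?_⟩)
    rw [strToNat_natToStr, strToNat_natToStr, hv s hts]

theorem IsUniversalOptimal.exists_complexity_le_of_late_halting (hU : IsUniversalOptimal U)
    (hF : IsStageApprox (U []) F) :
    ∃ c, ∀ {P p v : List Bool} {q : ℕ → ℕ} {n t : ℕ},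
      (∀ s, natToStr (q s) ∈ U (natToStr s) P) → (∀ s ≥ t, initSeg (natToRat (q s)) n = v) →
      natToStr n ∈ U [] p → natToStr n ∉ F t p →
      complexity U v ≤ p.length + (2 * P.length + 1 + c) := by
  obtain ⟨V, hV, hVv⟩ := exists_machine_of_late_halting hU.partrec hF
  obtain ⟨c, hc⟩ := hU.exists_complexity_le hV
  refine ⟨c, fun hq hv hn hlate => ?_⟩
  have hle := hc _ _ (hVv hq hv hn hlate)
  rwa [length_pairStr, add_assoc] at hle

/-- `p` is, in length-lexicographic order, the first program that outputs `x` at stage `s` of the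
approximation `F` of a machine. -/
def IsFirstProgram (F : ℕ → List Bool → Option (List Bool)) (s : ℕ) (x p : List Bool) : Prop :=
  x ∈ F s p ∧ ∀ k < strToNat p, x ∉ F s (natToStr k)

theorem IsFirstProgram.length_le {s : ℕ} {x p p' : List Bool} (h : IsFirstProgram F s x p)
    (hp' : x ∈ F s p') : p.length ≤ p'.length := by
  refine length_le_length_of_strToNat_le (le_of_not_gt fun hlt => h.2 _ hlt ?_)
  rwa [natToStr_strToNat]

theorem exists_isFirstProgram {s : ℕ} {x p : List Bool} (hp : x ∈ F s p) :
    ∃ p', IsFirstProgram F s x p' := by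
  have hex : ∃ k, x ∈ F s (natToStr k) := ⟨strToNat p, by rwa [natToStr_strToNat]⟩
  refine ⟨natToStr (Nat.find hex), Nat.find_spec hex, fun k hk => Nat.find_min hex ?_⟩
  rwa [strToNat_natToStr] at hk

theorem primrecPred_isFirstProgram (hF : Primrec₂ F) :
    PrimrecPred fun c : ℕ × List Bool × List Bool => IsFirstProgram F c.1 c.2.1 c.2.2 := by
  have hout : PrimrecPred fun c : ℕ × List Bool × List Bool => c.2.1 ∈ F c.1 c.2.2 :=
    Primrec.eq.comp (hF.comp Primrec.fst (Primrec.snd.comp Primrec.snd))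
      (Primrec.option_some.comp (Primrec.fst.comp Primrec.snd))
  have hearlier : PrimrecRel fun (k : ℕ) (c : ℕ × List Bool × List Bool) =>
      ¬ c.2.1 ∈ F c.1 (natToStr k) :=
    PrimrecPred.not (hout.comp ((Primrec.fst.comp Primrec.snd).pair
      ((Primrec.fst.comp (Primrec.snd.comp Primrec.snd)).pair
        (primrec_natToStr.comp Primrec.fst))))
  have hfirst : PrimrecPred fun c : ℕ × List Bool × List Bool =>
      ∀ k < strToNat c.2.2, ¬ c.2.1 ∈ F c.1 (natToStr k) :=
    (hearlier.forall_mem_list.comp (Primrec.list_range.comp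
      (primrec_strToNat.comp (Primrec.snd.comp Primrec.snd))) Primrec.id).of_eq fun c => by
        simp only [List.mem_range, id]
  exact hout.and hfirst

theorem IsStageApprox.exists_partrec_complexity (hF : IsStageApprox (U []) F) {α : Type*}
    [Primcodable α] {x : α → List Bool} (hx : Computable x) {R : α → ℕ → Bool}
    (hR : Computable₂ R) :
    ∃ f : α →. ℕ, Partrec f ∧ ∀ a, (∃ s, R a s) →
      (∀ s, R a s → ∃ p, p.length = complexity U (x a) ∧ x a ∈ F s p) →
      complexity U (x a) ∈ f a := by
  classical
  have hsearch : Computable₂ fun (a : α) (c : ℕ × List Bool) =>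
      R a c.1 && decide (IsFirstProgram F c.1 (x a) c.2) :=
    Primrec.and.to_comp.comp (hR.comp Computable.fst (Computable.fst.comp Computable.snd))
      ((primrecPred_isFirstProgram hF.primrec).decide.to_comp.comp
        ((Computable.fst.comp Computable.snd).pair
          ((hx.comp Computable.fst).pair (Computable.snd.comp Computable.snd))))
  obtain ⟨g, hg, hgR⟩ := exists_partrec_selector hsearch
  refine ⟨fun a => (g a).map fun c => c.2.length,
    hg.map (Computable.list_length.comp (Computable.snd.comp Computable.snd)).to₂,
    fun a ⟨s', hs'⟩ hshort => ?_⟩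
  obtain ⟨p', -, hp'⟩ := hshort s' hs'
  obtain ⟨p'', hp''⟩ := exists_isFirstProgram hp'
  obtain ⟨⟨s, p⟩, hc, hsp⟩ := hgR a ⟨(s', p''), by simp [hs', hp'']⟩
  obtain ⟨hs, hp⟩ : R a s ∧ IsFirstProgram F s (x a) p := by simpa using hsp
  obtain ⟨p₀, hlen, hp₀⟩ := hshort s hs
  refine (Part.mem_map_iff _).2 ⟨_, hc, le_antisymm ?_ ?_⟩
  · exact hlen ▸ hp.length_le hp₀
  · exact complexity_le (hF.mem_iff.2 ⟨s, hp.1⟩)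

theorem IsUniversalOptimal.exists_partrec_natComplexity (hU : IsUniversalOptimal U) :
    ∃ c, ∀ {P : List Bool} {α : ℝ}, Enumerates U P α → ¬ Computable (binDigit α) →
      ∃ f : ℕ × List Bool →. ℕ, Partrec f ∧ ∀ n,
        complexity U (initSeg α n) > natComplexity U n + (2 * P.length + 1 + c) →
        natComplexity U n ∈ f (n, initSeg α n) := by
  have hU₀ : Partrec (U []) := hU.partrec.comp (Computable.const []) Computable.id
  obtain ⟨F, hF⟩ := exists_isStageApprox hU₀
  obtain ⟨c, hc⟩ := hU.exists_complexity_le_of_late_halting hF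
  refine ⟨c, fun {P α} ⟨q, hq, hmono, hlim⟩ hα => ?_⟩
  obtain ⟨s₀, hs₀⟩ := exists_forall_initSeg_eq_of_le (Rat.cast_mono.comp hmono) hlim hα
  have hstage : Computable₂ fun (a : ℕ × List Bool) s =>
      decide (s₀ ≤ s ∧ initSeg (natToRat (q s)) a.1 = a.2) := by
    have hreached : PrimrecRel fun (a : ℕ × List Bool) (t : ℕ × ℕ) =>
        s₀ ≤ t.1 ∧ initSeg (natToRat t.2) a.1 = a.2 :=
      (Primrec.nat_le.comp (Primrec.const s₀) (Primrec.fst.comp Primrec.snd)).and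
        (Primrec.eq.comp (primrec₂_initSeg_natToRat.comp (Primrec.snd.comp Primrec.snd)
          (Primrec.fst.comp Primrec.fst)) (Primrec.snd.comp Primrec.fst))
    have hterm : Computable fun s => (s, q s) :=
      Computable.id.pair (computable_of_mem_natToStr hU.partrec hq)
    exact (hreached.decide.to_comp.comp (Computable.fst (β := ℕ)) (hterm.comp Computable.snd) :)
  obtain ⟨f, hf, hfC⟩ := hF.exists_partrec_complexity
    (primrec_natToStr.to_comp.comp Computable.fst) hstage
  refine ⟨f, hf, fun n hn => hfC (n, initSeg α n) ?_ fun s hs => ?_⟩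
  · obtain ⟨s, hs, hsn⟩ := ((Filter.eventually_ge_atTop s₀).and
      (eventually_initSeg_eq hlim hα n)).exists
    exact ⟨s, decide_eq_true ⟨hs, hsn.2⟩⟩
  · obtain ⟨hs, hsn⟩ := of_decide_eq_true hs
    obtain ⟨p, hp, hlen⟩ := hU.exists_shortest (natToStr n)
    refine ⟨p, hlen, by_contra fun hlate => hn.not_ge ?_⟩
    have hle := hc hq (fun t ht => hs₀ n s hs t ht hsn) hp hlate
    rwa [hlen] at hle

end HaltingTime

theorem mainTheorem10 (U : Machine) (hU : IsUniversalOptimal U) :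
    ∃ D : ℕ → ℕ, Computable D ∧
      ∀ α : ℝ, IsLeftCE α → ¬ Computable (binDigit α) →
        (∃ P : List Bool, Enumerates U P α) ∧
        ∀ P : List Bool, Enumerates U P α →
          ∃ Cstar : ℕ →. ℕ, TuringReducible Cstar (digitOracle α) ∧
            (∀ n : ℕ, complexity U (initSeg α n) > natComplexity U n + D P.length →
              natComplexity U n ∈ Cstar n) ∧
            {n : ℕ | complexity U (initSeg α n) > natComplexity U n + D P.length}.Infinite ∧
            {n : ℕ | natComplexity U n ∈ Cstar n}.Infinite := by
  obtain ⟨c, hc⟩ := hU.exists_partrec_natComplexity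
  have hD : Computable fun l => 2 * l + 1 + c :=
    (Primrec.nat_add.comp Primrec.nat_double_succ (Primrec.const c)).to_comp
  refine ⟨_, hD, fun α hα hdigits => ⟨hU.exists_enumerates hα, fun P hP => ?_⟩⟩
  obtain ⟨f, hf, hfC⟩ := hc hP hdigits
  have hinf := hU.infinite_setOf_complexity_bitPrefix_gt hdigits (2 * P.length + 1 + c)
  exact ⟨fun n => f (n, initSeg α n), turingReducible_of_partrec_bitPrefix hf (binDigit α), hfC,
    hinf, hinf.mono hfC⟩
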